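/- For $x\in\mathbb{C}$ and an integer $n\ge 0$ let $(x)_n=x(x+1)\cdots(x+n-1)$ (with $(x)_0=1$), and for complex $k$ let $(x)_k=\Gamma(x+k)/\Gamma(x)$; here $1/\Gamma$ is read as $0$ at the poles of $\Gamma$. (i) For every $k\in\mathbb{C}\setminus\{-1,-2,-3,\dots\}$ the following series converges absolutely, and $$\sum_{n=0}^{\infty}\left(\frac1{64}\right)^n\frac{\left(\frac12-k\right)_n\left(\frac12\right)_n\left(\frac12+k\right)_n\left(\frac12+2k\right)_n}{\left(\frac12+\frac k2\right)_n\left(1+\frac k2\right)_n(1+k)_n(1)_n}\cdot\frac{(42n+5)(2n+1)+k(84n+24k+26)}{2n+k+1}=\frac{16}{\pi}\cdot\frac{(1)_k^2}{\left(\frac14\right)_k\left(\frac34\right)_k}.$$ (ii) The formula is WZ-demonstrable in the following sense. Let $U$ be the set of $k\in\mathbb{C}$ such that none of $1+k$, $\frac14+k$, $\frac34+k$ lies in $\{0,-1,-2,\dots\}$, and let $G(n,k)$ be the $n$-th term of the series in (i) multiplied by $\left(\frac14\right)_k\left(\frac34\right)_k/(1)_k^2$. Then there is a function $F(n,k)$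 of $n\in\mathbb{Z}_{\ge0}$, $k\in U$ such that $(F,G)$ is a Wilf–Zeilberger pair, i.e. $F$ and $G$ are hypergeometric in both variables and $$F(n+1,k)-F(n,k)=G(n,k+1)-G(n,k)\qquad(n\ge0,\ k\in U),$$ and moreover $F(0,k)=0$ and $\lim_{n\to\infty}F(n,k)=0$ for all $k\in U$. Here $A(n,k)$ is called hypergeometric in both variables if there are nonzero complex polynomials $P,Q,\tilde P,\tilde Q$ in two variables with $Q(n,k)A(n+1,k)=P(n,k)A(n,k)$ and $\tilde Q(n,k)A(n,k+1)=\tilde P(n,k)A(n,k)$ for all $n\ge0$, $k\in U$. (iii) For $k=0$ the series in (i) is, term by term, Ramanujan's series, so that $$\sum_{n=0}^{\infty}\left(\frac1{64}\right)^n\frac{\left(\frac12\right)_n^3}{(1)_n^3}(42n+5)=\frac{16}{\pi}.$$ -/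

import Mathlib

namespace RamanujanWZ

noncomputable section

/-- The rising factorial `(x)_n = x (x + 1) ⋯ (x + n - 1)` for a natural number `n`. -/
def poch (x : ℂ) (n : ℕ) : ℂ := (ascPochhammer ℂ n).eval x

/-- The generalized Pochhammer symbol `(x)_k = Γ(x + k) / Γ(x)` for complex `k`. -/
def gammaPoch (x k : ℂ) : ℂ := Complex.Gamma (x + k) / Complex.Gamma x

/-- The `n`-th term of the series. -/
def summand (n : ℕ) (k : ℂ) : ℂ :=
  (1 / 64 : ℂ) ^ n *
    (poch (1 / 2 - k) n * poch (1 / 2) n * poch (1 / 2 + k) n * poch (1 / 2 + 2 * k) n /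
      (poch (1 / 2 + k / 2) n * poch (1 + k / 2) n * poch (1 + k) n * poch 1 n)) *
    (((42 * n + 5) * (2 * n + 1) + k * (84 * n + 24 * k + 26)) / (2 * n + k + 1))

/-- The summand normalized so that the value of the series does not depend on `k`. -/
def G (n : ℕ) (k : ℂ) : ℂ :=
  summand n k * (gammaPoch (1 / 4) k * gammaPoch (3 / 4) k / gammaPoch 1 k ^ 2)

/-- The complex `k` for which `(1)_k`, `(1/4)_k` and `(3/4)_k` are all defined, that is, none of
`1 + k`, `1/4 + k`, `3/4 + k` is in `{0, -1, -2, …}`. This set is stable under `k ↦ k + 1`. -/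
def domain : Set ℂ :=
  {k | ∀ m : ℕ, 1 + k ≠ -(m : ℂ) ∧ 1 / 4 + k ≠ -(m : ℂ) ∧ 3 / 4 + k ≠ -(m : ℂ)}

/-- The value of a polynomial in two variables at the point `(n, k)`. -/
def evalAt (P : MvPolynomial (Fin 2) ℂ) (n : ℕ) (k : ℂ) : ℂ :=
  MvPolynomial.eval ![(n : ℂ), k] P

/-- `A(n, k)` is hypergeometric in its two variables on `ℕ × U`: the quotients
`A(n + 1, k) / A(n, k)` and `A(n, k + 1) / A(n, k)` are rational functions `P / Q` of `(n, k)`.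
The quotients are written without denominators, because `A` may vanish at some points. -/
structure IsHypergeometricOn (U : Set ℂ) (A : ℕ → ℂ → ℂ) : Prop where
  shift_n : ∃ P Q : MvPolynomial (Fin 2) ℂ, P ≠ 0 ∧ Q ≠ 0 ∧
    ∀ n : ℕ, ∀ k ∈ U, evalAt Q n k * A (n + 1) k = evalAt P n k * A n k
  shift_k : ∃ P Q : MvPolynomial (Fin 2) ℂ, P ≠ 0 ∧ Q ≠ 0 ∧
    ∀ n : ℕ, ∀ k ∈ U, evalAt Q n k * A n (k + 1) = evalAt P n k * A n k

/-- `(F, G)` is a Wilf–Zeilberger pair on `ℕ × U`, for a set `U` stable under `k ↦ k + 1`. -/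
structure IsWZPairOn (U : Set ℂ) (F G : ℕ → ℂ → ℂ) : Prop where
  hypergeometric_F : IsHypergeometricOn U F
  hypergeometric_G : IsHypergeometricOn U G
  wz : ∀ n : ℕ, ∀ k ∈ U, F (n + 1) k - F n k = G n (k + 1) - G n k

end

end RamanujanWZ

namespace RamanujanWZ

/-! Write S(k) for the sum of the series and w(k) for `weight k`. The WZ identity
`summand_shift_sub` telescopes in n. Since the certificate is zero at n = 0 and tends to 0, S(k)
w(k) is unchanged by k ↦ k + 1 (`tsum_summand_shift`, `weight_shift`).

Periodicity alone does not make S(k) w(k) constant. For re k ≥ 0, let k run to infinity along k + ℕ: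
S(k)/k converges by dominated convergence (`tendsto_tsum_summand_shift`), and k w(k) converges by
Euler's limit for Γ (`tendsto_weight_shift`). Neither limit depends on the starting point, so S w is
constant on the half plane. The limiting series need not be evaluated: at k = 1/2 the factor (1/2 -
k)_n kills every term but the first, which gives 16 w(1/2) = 16/π.

The recurrence for S then carries the formula to the left, one unit strip at a time. It is compared
there with the recurrence for 1/w, which survives at the poles of Γ(1/4 + k) Γ(3/4 + k). -/

/-- The quotient of Pochhammer symbols in `summand`. -/
noncomputable def baseTerm (n : ℕ) (k : ℂ) : ℂ :=
  (1 / 64 : ℂ) ^ n *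
    (poch (1 / 2 - k) n * poch (1 / 2) n * poch (1 / 2 + k) n * poch (1 / 2 + 2 * k) n /
      (poch (1 / 2 + k / 2) n * poch (1 + k / 2) n * poch (1 + k) n * poch 1 n))

/-- The rational factor in `summand`. -/
noncomputable def rationalFactor (n : ℕ) (k : ℂ) : ℂ :=
  ((42 * n + 5) * (2 * n + 1) + k * (84 * n + 24 * k + 26)) / (2 * n + k + 1)

/-- The quotient of two consecutive values of `baseTerm`. -/
noncomputable def baseRatio (n : ℕ) (k : ℂ) : ℂ :=
  1 / 64 * (((1 / 2 - k + n) / (1 + k + n)) * ((1 / 2 + n) / (1 + n)) *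
    ((1 / 2 + k + n) / (1 + k / 2 + n)) * ((1 / 2 + 2 * k + n) / (1 / 2 + k / 2 + n)))

/-- The quotient of `certificate (n + 1) k` by `baseTerm n k`. -/
noncomputable def certificateFactor (n : ℕ) (k : ℂ) : ℂ :=
  (6 * n + 5) * (((2 * n + 1) / (2 * n + (k + 1))) * ((2 * n + (2 * k + 1)) / (2 * n + (k + 2))) *
    ((2 * n + (4 * k + 1)) / (1 * n + (k + 1)))) / 16

/-- The function `8 n (6 n - 1) / (n - 1/2 - k) * baseTerm n k`, with the vanishing denominators
cancelled. -/
noncomputable def certificate : ℕ → ℂ → ℂ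
  | 0, _ => 0
  | n + 1, k => baseTerm n k * certificateFactor n k

/-- The factor which makes the sum of the series independent of `k`. -/
noncomputable def weight (k : ℂ) : ℂ :=
  gammaPoch (1 / 4) k * gammaPoch (3 / 4) k / gammaPoch 1 k ^ 2

theorem summand_eq (n : ℕ) (k : ℂ) : summand n k = baseTerm n k * rationalFactor n k := rfl

theorem G_eq (n : ℕ) (k : ℂ) : G n k = summand n k * weight k := rfl

theorem poch_zero (x : ℂ) : poch x 0 = 1 := by simp [poch]

theorem poch_succ (x : ℂ) (n : ℕ) : poch x (n + 1) = poch x n * (x + n) := by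
  simp [poch, ascPochhammer_succ_eval]

theorem baseTerm_zero (k : ℂ) : baseTerm 0 k = 1 := by simp [baseTerm, poch_zero]

theorem baseTerm_succ (n : ℕ) (k : ℂ) : baseTerm (n + 1) k = baseTerm n k * baseRatio n k := by
  simp only [baseTerm, baseRatio, poch_succ, pow_succ]
  simp only [div_eq_mul_inv, mul_inv]
  ring

/-! ### Shift relations and the Wilf–Zeilberger identity -/

section nonvanishing

variable {k : ℂ} (hk : ∀ m : ℕ, 1 + k ≠ -(m : ℂ))
include hk

theorem natCast_add_ne_zero (n : ℕ) : (n : ℂ) + k + 1 ≠ 0 := fun h =>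
  hk n (by linear_combination h)

theorem two_mul_add_one_ne_zero (n : ℕ) : 2 * (n : ℂ) + k + 1 ≠ 0 := by
  simpa using natCast_add_ne_zero hk (2 * n)

theorem two_mul_add_two_ne_zero (n : ℕ) : 2 * (n : ℂ) + k + 2 ≠ 0 := fun h =>
  natCast_add_ne_zero hk (2 * n + 1) (by push_cast; linear_combination h)

theorem one_add_succ_ne (m : ℕ) : 1 + (k + 1) ≠ -(m : ℂ) := fun h =>
  hk (m + 1) (by push_cast; linear_combination h)

theorem baseRatio_eq (n : ℕ) : baseRatio n k =
    (2 * n + 1 - 2 * k) * (2 * n + 1) * (2 * n + 2 * k + 1) * (2 * n + 4 * k + 1) /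
      (256 * (2 * n + k + 1) * (2 * n + k + 2) * (n + k + 1) * (n + 1)) := by
  have h1 := natCast_add_ne_zero hk n
  have h2 := two_mul_add_one_ne_zero hk n
  have h3 := two_mul_add_two_ne_zero hk n
  have h4 : (n : ℂ) + 1 ≠ 0 := Nat.cast_add_one_ne_zero n
  have e1 : 1 + k + n = n + k + 1 := by ring
  have e2 : 1 + k / 2 + n = (2 * n + k + 2) / 2 := by ring
  have e3 : 1 / 2 + k / 2 + n = (2 * n + k + 1) / 2 := by ring
  rw [baseRatio, e1, e2, e3, add_comm 1 (n : ℂ)]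
  field_simp
  ring

theorem certificateFactor_eq (n : ℕ) : certificateFactor n k =
    (6 * n + 5) * (2 * n + 1) * (2 * n + 2 * k + 1) * (2 * n + 4 * k + 1) /
      (16 * (2 * n + k + 1) * (2 * n + k + 2) * (n + k + 1)) := by
  have h1 := natCast_add_ne_zero hk n
  have h2 := two_mul_add_one_ne_zero hk n
  have h3 := two_mul_add_two_ne_zero hk n
  rw [certificateFactor, one_mul, ← add_assoc, ← add_assoc, ← add_assoc, ← add_assoc, ← add_assoc]
  field_simp

theorem rationalFactor_eq (n : ℕ) :
    rationalFactor n k = 42 * n + 5 + 21 * k + 3 * k ^ 2 / (2 * n + k + 1) := by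
  have h2 := two_mul_add_one_ne_zero hk n
  rw [rationalFactor, div_eq_iff h2, add_mul _ (3 * k ^ 2 / _), div_mul_cancel₀ _ h2]
  ring

/-- Moving n and k together avoids a division: (-1/2 - k)_{n+1} = (-1/2 - k) (1/2 - k)_n. The
prefactor on the left clears the denominator from (5/2 + 2k)_{n+1}, and the minus sign is (-1/2 -
k)/(1/2 + k). -/
theorem baseTerm_succ_shift (n : ℕ) :
    (1 / 4 + k) * (3 / 4 + k) * baseTerm (n + 1) (k + 1) = baseTerm n k *
      (-((1 + k) ^ 2 * (2 * n + 1) * (2 * n + 2 * k + 1) * (2 * n + 2 * k + 3) *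
          (2 * n + 4 * k + 1) * (2 * n + 4 * k + 3) * (2 * n + 4 * k + 5)) /
        (4096 * (n + 1) * (2 * n + k + 1) * (2 * n + k + 2) * (2 * n + k + 3) * (n + k + 1) *
          (n + k + 2))) := by
  have hk' := one_add_succ_ne hk
  induction n with
  | zero =>
    have h1 := natCast_add_ne_zero hk 0
    have h2 := natCast_add_ne_zero hk 1
    have h3 := natCast_add_ne_zero hk 2
    rw [baseTerm_succ, baseTerm_zero, baseTerm_zero, baseRatio_eq hk']
    push_cast at h1 h2 h3 ⊢
    -- Every linear denominator is put in the shape m + k + 1 of the nonvanishing hypotheses, so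
    -- that `field_simp` recognizes it.
    have e1 : 2 * (0 : ℂ) + (k + 1) + 1 = 1 + k + 1 := by ring
    have e2 : 2 * (0 : ℂ) + (k + 1) + 2 = 2 + k + 1 := by ring
    have e3 : (0 : ℂ) + (k + 1) + 1 = 1 + k + 1 := by ring
    have e4 : 2 * (0 : ℂ) + k + 1 = 0 + k + 1 := by ring
    have e5 : 2 * (0 : ℂ) + k + 2 = 1 + k + 1 := by ring
    have e6 : 2 * (0 : ℂ) + k + 3 = 2 + k + 1 := by ring
    have e7 : (0 : ℂ) + k + 2 = 1 + k + 1 := by ring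
    rw [e1, e2, e3, e4, e5, e6, e7]
    field_simp
    ring
  | succ n ih =>
    have h1 := natCast_add_ne_zero hk n
    have h2 := natCast_add_ne_zero hk (n + 1)
    have h3 := natCast_add_ne_zero hk (n + 2)
    have h4 := natCast_add_ne_zero hk (2 * n)
    have h5 := natCast_add_ne_zero hk (2 * n + 1)
    have h6 := natCast_add_ne_zero hk (2 * n + 2)
    have h7 := natCast_add_ne_zero hk (2 * n + 3)
    have h8 := natCast_add_ne_zero hk (2 * n + 4)
    have h9 : (n : ℂ) + 1 ≠ 0 := Nat.cast_add_one_ne_zero n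
    have h10 : (n : ℂ) + 1 + 1 ≠ 0 := by
      simpa using Nat.cast_add_one_ne_zero (R := ℂ) (n + 1)
    rw [baseTerm_succ (n + 1), ← mul_assoc, ih, baseTerm_succ n k, mul_assoc (baseTerm n k),
      mul_assoc (baseTerm n k), baseRatio_eq hk, baseRatio_eq hk']
    refine congrArg (baseTerm n k * ·) ?_
    push_cast at h1 h2 h3 h4 h5 h6 h7 h8 ⊢
    have e1 : 2 * ((n : ℂ) + 1) + (k + 1) + 1 = 2 * n + 3 + k + 1 := by ring
    have e2 : 2 * ((n : ℂ) + 1) + (k + 1) + 2 = 2 * n + 4 + k + 1 := by ring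
    have e3 : (n : ℂ) + 1 + (k + 1) + 1 = n + 2 + k + 1 := by ring
    have e4 : 2 * (n : ℂ) + k + 2 = 2 * n + 1 + k + 1 := by ring
    have e5 : 2 * (n : ℂ) + k + 3 = 2 * n + 2 + k + 1 := by ring
    have e6 : (n : ℂ) + k + 2 = n + 1 + k + 1 := by ring
    have e7 : 2 * ((n : ℂ) + 1) + k + 1 = 2 * n + 2 + k + 1 := by ring
    have e8 : 2 * ((n : ℂ) + 1) + k + 2 = 2 * n + 3 + k + 1 := by ring
    have e9 : 2 * ((n : ℂ) + 1) + k + 3 = 2 * n + 4 + k + 1 := by ring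
    have e10 : (n : ℂ) + 1 + k + 2 = n + 2 + k + 1 := by ring
    rw [e1, e2, e3, e4, e5, e6, e7, e8, e9, e10]
    field_simp
    ring

/-- With n fixed, (-1/2 - k)_n (n - 1/2 - k) = (-1/2 - k) (1/2 - k)_n. The factor 2n - 1 - 2k must
stay on the left because it vanishes at k = n - 1/2. -/
theorem baseTerm_shift (n : ℕ) :
    (2 * n - 1 - 2 * k) * ((1 / 4 + k) * (3 / 4 + k) * baseTerm n (k + 1)) = baseTerm n k *
      (-((1 + k) ^ 2 * (2 * n + 2 * k + 1) * (2 * n + 4 * k + 1) * (2 * n + 4 * k + 3)) /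
        (16 * (2 * n + k + 1) * (n + k + 1))) := by
  cases n with
  | zero =>
    have h1 := natCast_add_ne_zero hk 0
    rw [baseTerm_zero, baseTerm_zero]
    push_cast at h1 ⊢
    have e4 : 2 * (0 : ℂ) + k + 1 = 0 + k + 1 := by ring
    rw [e4]
    field_simp
    ring
  | succ n =>
    have h1 := natCast_add_ne_zero hk n
    have h2 := natCast_add_ne_zero hk (n + 1)
    have h4 := natCast_add_ne_zero hk (2 * n)
    have h5 := natCast_add_ne_zero hk (2 * n + 1)
    have h6 := natCast_add_ne_zero hk (2 * n + 2)
    have h9 : (n : ℂ) + 1 ≠ 0 := Nat.cast_add_one_ne_zero n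
    rw [baseTerm_succ_shift hk, baseTerm_succ, baseRatio_eq hk]
    push_cast at h1 h2 h4 h5 h6 ⊢
    have e4 : 2 * (n : ℂ) + k + 2 = 2 * n + 1 + k + 1 := by ring
    have e5 : 2 * (n : ℂ) + k + 3 = 2 * n + 2 + k + 1 := by ring
    have e6 : (n : ℂ) + k + 2 = n + 1 + k + 1 := by ring
    have e7 : 2 * ((n : ℂ) + 1) + k + 1 = 2 * n + 2 + k + 1 := by ring
    rw [e4, e5, e6, e7]
    field_simp
    ring

/-- The Wilf–Zeilberger identity, before normalization. -/
theorem summand_shift_sub (n : ℕ) :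
    (1 / 4 + k) * (3 / 4 + k) * summand n (k + 1) - (1 + k) ^ 2 * summand n k =
      (1 + k) ^ 2 * (certificate (n + 1) k - certificate n k) := by
  cases n with
  | zero =>
    have h1 := natCast_add_ne_zero hk 0
    have h2 := natCast_add_ne_zero hk 1
    simp only [summand_eq, certificate, baseTerm_zero, certificateFactor_eq hk, rationalFactor]
    push_cast at h1 h2 ⊢
    have e1 : 2 * (0 : ℂ) + (k + 1) + 1 = 1 + k + 1 := by ring
    have e4 : 2 * (0 : ℂ) + k + 1 = 0 + k + 1 := by ring
    have e5 : 2 * (0 : ℂ) + k + 2 = 1 + k + 1 := by ring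
    rw [e1, e4, e5]
    field_simp
    ring
  | succ n =>
    have h1 := natCast_add_ne_zero hk n
    have h2 := natCast_add_ne_zero hk (n + 1)
    have h4 := natCast_add_ne_zero hk (2 * n)
    have h5 := natCast_add_ne_zero hk (2 * n + 1)
    have h6 := natCast_add_ne_zero hk (2 * n + 2)
    have h7 := natCast_add_ne_zero hk (2 * n + 3)
    have h9 : (n : ℂ) + 1 ≠ 0 := Nat.cast_add_one_ne_zero n
    -- All four terms become rational multiples of `baseTerm n k`, which leaves an identity of
    -- rational functions.
    rw [summand_eq, ← mul_assoc, baseTerm_succ_shift hk, summand_eq, certificate, certificate,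
      baseTerm_succ n k, baseRatio_eq hk, certificateFactor_eq hk, certificateFactor_eq hk,
      rationalFactor, rationalFactor]
    generalize baseTerm n k = t
    push_cast at h1 h2 h4 h5 h6 h7 ⊢
    have e1 : 2 * ((n : ℂ) + 1) + (k + 1) + 1 = 2 * n + 3 + k + 1 := by ring
    have e4 : 2 * (n : ℂ) + k + 2 = 2 * n + 1 + k + 1 := by ring
    have e5 : 2 * (n : ℂ) + k + 3 = 2 * n + 2 + k + 1 := by ring
    have e6 : (n : ℂ) + k + 2 = n + 1 + k + 1 := by ring
    have e7 : 2 * ((n : ℂ) + 1) + k + 1 = 2 * n + 2 + k + 1 := by ring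
    have e8 : 2 * ((n : ℂ) + 1) + k + 2 = 2 * n + 3 + k + 1 := by ring
    have h6' := e7 ▸ h6
    rw [e1, e4, e5, e6, e7, e8]
    field_simp
    ring

end nonvanishing

/-! ### The Gamma weight and the Wilf–Zeilberger pair -/

theorem gammaPoch_add_one {x k : ℂ} (h : x + k ≠ 0) :
    gammaPoch x (k + 1) = (x + k) * gammaPoch x k := by
  rw [gammaPoch, gammaPoch, ← add_assoc, Complex.Gamma_add_one _ h, mul_div_assoc]

theorem gammaPoch_one_ne_zero {k : ℂ} (hk : ∀ m : ℕ, 1 + k ≠ -(m : ℂ)) : gammaPoch 1 k ≠ 0 := by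
  rw [gammaPoch, Complex.Gamma_one, div_one]
  exact Complex.Gamma_ne_zero hk

theorem weight_shift {k : ℂ} (hk : k ∈ domain) :
    (1 + k) ^ 2 * weight (k + 1) = (1 / 4 + k) * (3 / 4 + k) * weight k := by
  have h0 := hk 0
  simp only [Nat.cast_zero, neg_zero] at h0
  have h1 := gammaPoch_one_ne_zero fun m => (hk m).1
  have h2 := h0.1
  rw [weight, weight, gammaPoch_add_one h0.1, gammaPoch_add_one h0.2.1, gammaPoch_add_one h0.2.2]
  field_simp

theorem hypergeometric_G : IsHypergeometricOn domain G := by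
  constructor
  · let N : MvPolynomial (Fin 2) ℂ := .X 0
    let K : MvPolynomial (Fin 2) ℂ := .X 1
    refine ⟨(2 * N + 1 - 2 * K) * (2 * N + 1) * (2 * N + 2 * K + 1) * (2 * N + 4 * K + 1) *
      ((42 * (N + 1) + 5) * (2 * (N + 1) + 1) + K * (84 * (N + 1) + 24 * K + 26)),
      256 * (2 * N + K + 2) * (N + K + 1) * (N + 1) * (2 * N + K + 3) *
      ((42 * N + 5) * (2 * N + 1) + K * (84 * N + 24 * K + 26)), ?_, ?_, ?_⟩
    · intro h
      have := congrArg (MvPolynomial.eval ![0, 0]) h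
      norm_num [N, K] at this
    · intro h
      have := congrArg (MvPolynomial.eval ![0, 0]) h
      norm_num [N, K] at this
    · intro n k hk
      replace hk := fun m => (hk m).1
      have h1 := natCast_add_ne_zero hk n
      have h2 := two_mul_add_one_ne_zero hk n
      have h3 := two_mul_add_two_ne_zero hk n
      have h4 := two_mul_add_one_ne_zero hk (n + 1)
      have h5 : (n : ℂ) + 1 ≠ 0 := Nat.cast_add_one_ne_zero n
      have e : 2 * ((n : ℂ) + 1) + k + 1 = 2 * n + k + 3 := by ring
      push_cast at h4
      rw [e] at h4
      simp only [evalAt, N, K, map_add, map_mul, map_sub, MvPolynomial.eval_X, map_ofNat, map_one,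
        Matrix.cons_val_zero, Matrix.cons_val_one, G_eq, summand_eq, baseTerm_succ,
        baseRatio_eq hk, rationalFactor]
      push_cast
      rw [e]
      generalize ((42 * (n : ℂ) + 5) * (2 * n + 1) + k * (84 * n + 24 * k + 26)) = p
      generalize (42 * ((n : ℂ) + 1) + 5) * (2 * (n + 1) + 1) + k * (84 * (n + 1) + 24 * k + 26) = q
      field_simp
  · let N : MvPolynomial (Fin 2) ℂ := .X 0
    let K : MvPolynomial (Fin 2) ℂ := .X 1
    refine ⟨-((2 * N + 2 * K + 1) * (2 * N + 4 * K + 1) * (2 * N + 4 * K + 3)) *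
      ((42 * N + 5) * (2 * N + 1) + (K + 1) * (84 * N + 24 * (K + 1) + 26)),
      16 * (2 * N - 1 - 2 * K) * (N + K + 1) * (2 * N + K + 2) *
      ((42 * N + 5) * (2 * N + 1) + K * (84 * N + 24 * K + 26)), ?_, ?_, ?_⟩
    · intro h
      have := congrArg (MvPolynomial.eval ![0, 0]) h
      norm_num [N, K] at this
    · intro h
      have := congrArg (MvPolynomial.eval ![0, 0]) h
      norm_num [N, K] at this
    · intro n k hk
      have hw := weight_shift hk
      replace hk := fun m => (hk m).1
      have h0 : 1 + k ≠ 0 := by simpa using hk 0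
      have h1 := natCast_add_ne_zero hk n
      have h2 := two_mul_add_one_ne_zero hk n
      have h3 := two_mul_add_two_ne_zero hk n
      have ht := baseTerm_shift hk n
      have e : 2 * (n : ℂ) + (k + 1) + 1 = 2 * n + k + 2 := by ring
      simp only [evalAt, N, K, map_add, map_mul, map_sub, map_neg, MvPolynomial.eval_X, map_ofNat,
        map_one, Matrix.cons_val_zero, Matrix.cons_val_one, G_eq, summand_eq, rationalFactor]
      rw [e]
      generalize ((42 * (n : ℂ) + 5) * (2 * n + 1) + k * (84 * n + 24 * k + 26)) = p
      generalize (42 * (n : ℂ) + 5) * (2 * n + 1) + (k + 1) * (84 * n + 24 * (k + 1) + 26) = q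
      -- The factor (1 + k)² lets `weight_shift` produce exactly the (1/4 + k)(3/4 + k) that
      -- `baseTerm_shift` needs.
      apply mul_left_cancel₀ (pow_ne_zero 2 h0)
      calc _ = 16 * (n + k + 1) * (2 * n + k + 2) * p * (q / (2 * n + k + 2)) *
            ((2 * n - 1 - 2 * k) * baseTerm n (k + 1)) * ((1 + k) ^ 2 * weight (k + 1)) := by ring
        _ = 16 * (n + k + 1) * (2 * n + k + 2) * p * (q / (2 * n + k + 2)) * weight k *
            ((2 * n - 1 - 2 * k) * ((1 / 4 + k) * (3 / 4 + k) * baseTerm n (k + 1))) := by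
          rw [hw]; ring
        _ = _ := by
          rw [ht]
          generalize 2 * (n : ℂ) + k + 2 = u at h3 ⊢
          generalize 2 * (n : ℂ) + k + 1 = v at h2 ⊢
          field_simp

theorem hypergeometric_certificate :
    IsHypergeometricOn domain fun n k => certificate n k * weight k := by
  constructor
  · let N : MvPolynomial (Fin 2) ℂ := .X 0
    let K : MvPolynomial (Fin 2) ℂ := .X 1
    -- The factor N in the second polynomial covers n = 0, where the certificate is 0 but its
    -- successor need not be. It also forces the nonvanishing test away from the origin.
    refine ⟨(2 * N + 1) * (2 * N + 2 * K + 1) * (2 * N + 4 * K + 1) * (2 * N - 1 - 2 * K) *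
        (6 * N + 5),
      256 * (2 * N + K + 1) * (2 * N + K + 2) * (N + K + 1) * N * (6 * N - 1), ?_, ?_, ?_⟩
    · intro h
      have := congrArg (MvPolynomial.eval ![1, 1]) h
      norm_num [N, K] at this
    · intro h
      have := congrArg (MvPolynomial.eval ![1, 1]) h
      norm_num [N, K] at this
    · intro n k hk
      replace hk := fun m => (hk m).1
      simp only [evalAt, N, K, map_add, map_mul, map_sub, MvPolynomial.eval_X, map_ofNat, map_one,
        Matrix.cons_val_zero, Matrix.cons_val_one]
      cases n with
      | zero => simp [certificate]
      | succ n =>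
        have h1 := natCast_add_ne_zero hk n
        have h2 := two_mul_add_one_ne_zero hk n
        have h3 := two_mul_add_two_ne_zero hk n
        have h4 := two_mul_add_one_ne_zero hk (n + 1)
        have h5 := two_mul_add_two_ne_zero hk (n + 1)
        have h6 := natCast_add_ne_zero hk (n + 1)
        have h7 : (n : ℂ) + 1 ≠ 0 := Nat.cast_add_one_ne_zero n
        push_cast at h4 h5 h6
        simp only [certificate, baseTerm_succ n, baseRatio_eq hk, certificateFactor_eq hk]
        push_cast
        field_simp
        ring
  · let N : MvPolynomial (Fin 2) ℂ := .X 0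
    let K : MvPolynomial (Fin 2) ℂ := .X 1
    refine ⟨-((2 * N + 4 * K + 1) * (2 * N + 2 * K + 1) * (2 * N + 4 * K + 3)),
      16 * (2 * N - 3 - 2 * K) * (2 * N + K + 1) * (N + K + 1), ?_, ?_, ?_⟩
    · intro h
      have := congrArg (MvPolynomial.eval ![1, 1]) h
      norm_num [N, K] at this
    · intro h
      have := congrArg (MvPolynomial.eval ![1, 1]) h
      norm_num [N, K] at this
    · intro n k hk
      simp only [evalAt, N, K, map_add, map_mul, map_sub, map_neg, MvPolynomial.eval_X, map_ofNat,
        map_one, Matrix.cons_val_zero, Matrix.cons_val_one]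
      cases n with
      | zero => simp [certificate]
      | succ n =>
        have hw := weight_shift hk
        replace hk := fun m => (hk m).1
        have h0 : 1 + k ≠ 0 := by simpa using hk 0
        have h1 := natCast_add_ne_zero hk n
        have h2 := two_mul_add_one_ne_zero hk n
        have h3 := two_mul_add_two_ne_zero hk n
        have h4 := two_mul_add_one_ne_zero hk (n + 1)
        have h6 := natCast_add_ne_zero hk (n + 1)
        have ht := baseTerm_shift hk n
        have e1 : 2 * (n : ℂ) + (k + 1) + 1 = 2 * n + k + 2 := by ring
        have e2 : 2 * (n : ℂ) + (k + 1) + 2 = 2 * (n + 1) + k + 1 := by ring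
        have e3 : (n : ℂ) + (k + 1) + 1 = n + 1 + k + 1 := by ring
        push_cast at h4 h6
        simp only [certificate, certificateFactor_eq hk,
          certificateFactor_eq (one_add_succ_ne hk)]
        rw [e1, e2, e3]
        push_cast
        apply mul_left_cancel₀ (pow_ne_zero 2 h0)
        generalize hA : (6 * (n : ℂ) + 5) * (2 * n + 1) * (2 * n + 2 * (k + 1) + 1) *
          (2 * n + 4 * (k + 1) + 1) /
          (16 * (2 * n + k + 2) * (2 * (n + 1) + k + 1) * (n + 1 + k + 1)) = A
        calc _ = 16 * (2 * ((n : ℂ) + 1) + k + 1) * (n + 1 + k + 1) * A *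
              ((2 * n - 1 - 2 * k) * baseTerm n (k + 1)) * ((1 + k) ^ 2 * weight (k + 1)) := by
              ring
          _ = 16 * (2 * ((n : ℂ) + 1) + k + 1) * (n + 1 + k + 1) * A * weight k *
              ((2 * n - 1 - 2 * k) * ((1 / 4 + k) * (3 / 4 + k) * baseTerm n (k + 1))) := by
            rw [hw]; ring
          _ = _ := by rw [ht, ← hA]; field_simp; ring

theorem isWZPairOn : IsWZPairOn domain (fun n k => certificate n k * weight k) G where
  hypergeometric_F := hypergeometric_certificate
  hypergeometric_G := hypergeometric_G
  wz n k hk := by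
    have hw := weight_shift hk
    replace hk := fun m => (hk m).1
    have h0 : 1 + k ≠ 0 := by simpa using hk 0
    have h := summand_shift_sub hk n
    rw [G_eq, G_eq]
    apply mul_left_cancel₀ (pow_ne_zero 2 h0)
    linear_combination (-weight k) * h - summand n (k + 1) * hw

open Filter Topology

/-! ### Convergence for fixed `k` -/

theorem tendsto_affine_div (a b c : ℂ) {d : ℂ} (hd : d ≠ 0) :
    Tendsto (fun n : ℕ => (c * n + a) / (d * n + b)) atTop (𝓝 (c / d)) := by
  simpa only [add_comm] using tendsto_add_mul_div_add_mul_atTop_nhds a b c hd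

theorem tendsto_const_div_affine (a b : ℂ) {d : ℂ} (hd : d ≠ 0) :
    Tendsto (fun n : ℕ => a / (d * n + b)) atTop (𝓝 0) := by
  simpa using tendsto_affine_div a b 0 hd

theorem tendsto_baseRatio (k : ℂ) : Tendsto (baseRatio · k) atTop (𝓝 (1 / 64)) := by
  have h (a b : ℂ) : Tendsto (fun n : ℕ => (a + n) / (b + n)) atTop (𝓝 1) := by
    simpa [add_comm] using tendsto_affine_div a b 1 one_ne_zero
  simpa only [baseRatio, mul_one] using
    ((((h (1 / 2 - k) (1 + k)).mul (h (1 / 2) 1)).mul (h (1 / 2 + k) (1 + k / 2))).mul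
      (h (1 / 2 + 2 * k) (1 / 2 + k / 2))).const_mul (1 / 64)

/-- Ratio test, with limit 1/64. The weight (n + 1)² absorbs the linear growth of both
`rationalFactor` and `certificateFactor`. -/
theorem summable_baseTerm_mul_sq (k : ℂ) :
    Summable fun n : ℕ => baseTerm n k * ((n : ℂ) + 1) ^ 2 := by
  have h1 : Tendsto (fun n : ℕ => ((n : ℂ) + 2) / (n + 1)) atTop (𝓝 1) := by
    simpa using tendsto_affine_div 2 1 1 one_ne_zero
  have h2 := ((tendsto_baseRatio k).mul (h1.pow 2)).norm
  refine summable_of_ratio_norm_eventually_le (r := 1 / 2) (by norm_num) ?_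
  filter_upwards [h2.eventually_le_const (show _ < (1 / 2 : ℝ) by norm_num)] with n hn
  have h3 : (n : ℂ) + 1 ≠ 0 := Nat.cast_add_one_ne_zero n
  have h4 : baseTerm (n + 1) k * (((n + 1 : ℕ) : ℂ) + 1) ^ 2 =
      (baseRatio n k * (((n : ℂ) + 2) / (n + 1)) ^ 2) * (baseTerm n k * ((n : ℂ) + 1) ^ 2) := by
    rw [baseTerm_succ]
    push_cast
    field_simp
    ring
  rw [h4, norm_mul]
  gcongr

theorem tendsto_certificateFactor_div_sq (k : ℂ) :
    Tendsto (fun n : ℕ => certificateFactor n k / ((n : ℂ) + 1) ^ 2) atTop (𝓝 0) := by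
  have h := ((((tendsto_affine_div 5 1 6 (one_ne_zero' ℂ)).mul
    (((tendsto_affine_div 1 (k + 1) 2 (two_ne_zero' ℂ)).mul
      (tendsto_affine_div (2 * k + 1) (k + 2) 2 (two_ne_zero' ℂ))).mul
      (tendsto_affine_div (4 * k + 1) (k + 1) 2 (one_ne_zero' ℂ)))).div_const 16).mul
    (tendsto_const_div_affine 1 1 (one_ne_zero' ℂ)))
  rw [mul_zero] at h
  refine h.congr fun n => ?_
  rw [certificateFactor, one_mul (n : ℂ)]
  generalize ((2 * (n : ℂ) + 1) / (2 * n + (k + 1))) * ((2 * n + (2 * k + 1)) / (2 * n + (k + 2))) *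
    ((2 * n + (4 * k + 1)) / (n + (k + 1))) = A
  have h3 : (n : ℂ) + 1 ≠ 0 := Nat.cast_add_one_ne_zero n
  field_simp

theorem tendsto_certificate (k : ℂ) : Tendsto (certificate · k) atTop (𝓝 0) := by
  rw [← tendsto_add_atTop_iff_nat 1]
  have h := (summable_baseTerm_mul_sq k).tendsto_atTop_zero.mul
    (tendsto_certificateFactor_div_sq k)
  rw [mul_zero] at h
  refine h.congr fun n => ?_
  have h3 : (n : ℂ) + 1 ≠ 0 := Nat.cast_add_one_ne_zero n
  rw [certificate]
  field_simp

section recurrence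

variable {k : ℂ} (hk : ∀ m : ℕ, 1 + k ≠ -(m : ℂ))
include hk

theorem tendsto_rationalFactor_div_sq :
    Tendsto (fun n : ℕ => rationalFactor n k / ((n : ℂ) + 1) ^ 2) atTop (𝓝 0) := by
  have h := ((tendsto_affine_div (5 + 21 * k) 1 42 (one_ne_zero' ℂ)).add
    ((tendsto_const_div_affine (3 * k ^ 2) (k + 1) (two_ne_zero' ℂ)).mul
      (tendsto_const_div_affine 1 1 (one_ne_zero' ℂ)))).mul
    (tendsto_const_div_affine 1 1 (one_ne_zero' ℂ))
  rw [mul_zero] at h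
  refine h.congr fun n => ?_
  rw [rationalFactor_eq hk, one_mul, ← add_assoc _ k]
  generalize 3 * k ^ 2 / (2 * (n : ℂ) + k + 1) = A
  have h3 : (n : ℂ) + 1 ≠ 0 := Nat.cast_add_one_ne_zero n
  field_simp
  ring

theorem summable_summand : Summable (summand · k) := by
  have h := (summable_baseTerm_mul_sq k).norm.mul_tendsto_const
    (by rw [Nat.cofinite_eq_atTop]; exact tendsto_rationalFactor_div_sq hk)
  refine h.congr fun n => ?_
  have h3 : (n : ℂ) + 1 ≠ 0 := Nat.cast_add_one_ne_zero n
  rw [summand_eq]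
  field_simp

theorem tsum_summand_shift :
    (1 / 4 + k) * (3 / 4 + k) * ∑' n, summand n (k + 1) = (1 + k) ^ 2 * ∑' n, summand n k := by
  have h1 := (summable_summand (one_add_succ_ne hk)).hasSum.mul_left ((1 / 4 + k) * (3 / 4 + k))
  have h2 := (summable_summand hk).hasSum.mul_left ((1 + k) ^ 2)
  have h3 := (h1.sub h2).tendsto_sum_nat
  have h4 : Tendsto (fun N : ℕ => (1 + k) ^ 2 * certificate N k) atTop (𝓝 0) := by
    simpa using (tendsto_certificate k).const_mul ((1 + k) ^ 2)
  refine sub_eq_zero.1 (tendsto_nhds_unique h3 (h4.congr fun N => ?_))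
  simp only [summand_shift_sub hk, ← Finset.mul_sum, Finset.sum_range_sub (certificate · k)]
  simp [certificate]

end recurrence

/-! ### The half plane `0 ≤ re k` -/

theorem norm_div_le_of_re_of_im {z w : ℂ} {C : ℝ} (hC : 0 ≤ C) (hre : |z.re| ≤ C * w.re)
    (him : |z.im| ≤ C * |w.im|) : ‖z / w‖ ≤ C := by
  rw [norm_div]
  refine div_le_of_le_mul₀ (norm_nonneg _) hC ?_
  refine (sq_le_sq₀ (norm_nonneg _) (by positivity)).1 ?_
  rw [mul_pow, Complex.sq_norm, Complex.sq_norm, Complex.normSq_apply, Complex.normSq_apply]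
  have h1 := mul_self_le_mul_self (abs_nonneg _) hre
  have h2 := mul_self_le_mul_self (abs_nonneg _) him
  rw [abs_mul_abs_self] at h1 h2
  have h3 := abs_mul_abs_self w.im
  linear_combination h1 + h2 + C ^ 2 * h3

theorem one_add_ne_of_re_nonneg {k : ℂ} (hk : 0 ≤ k.re) (m : ℕ) : 1 + k ≠ -(m : ℂ) := by
  intro h
  have := congrArg Complex.re h
  simp at this
  have := Nat.cast_nonneg (α := ℝ) m
  linarith

/-- The four quotients are bounded by 1, 1, 2 and 4, comparing real and imaginary parts. Uniformity
in k supplies the geometric majorant for dominated convergence. -/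
theorem norm_baseRatio_le {k : ℂ} (hk : 0 ≤ k.re) (n : ℕ) : ‖baseRatio n k‖ ≤ 1 / 8 := by
  have hn : (0 : ℝ) ≤ n := Nat.cast_nonneg n
  have h1 : ‖(1 / 2 - k + n) / (1 + k + n)‖ ≤ 1 := by
    apply norm_div_le_of_re_of_im one_pos.le
    · rw [abs_le]
      constructor <;> simp <;> linarith
    · simp
  have h2 : ‖(1 / 2 + n) / (1 + n : ℂ)‖ ≤ 1 := by
    apply norm_div_le_of_re_of_im one_pos.le
    · rw [abs_le]
      constructor <;> simp <;> linarith
    · simp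
  have h3 : ‖(1 / 2 + k + n) / (1 + k / 2 + n)‖ ≤ 2 := by
    apply norm_div_le_of_re_of_im two_pos.le
    · rw [abs_le]
      constructor <;> simp <;> linarith
    · simp [abs_div, mul_div_cancel₀]
  have h4 : ‖(1 / 2 + 2 * k + n) / (1 / 2 + k / 2 + n)‖ ≤ 4 := by
    apply norm_div_le_of_re_of_im four_pos.le
    · rw [abs_le]
      constructor <;> simp <;> linarith
    · simp [abs_div, abs_mul]
      linarith
  rw [baseRatio, norm_mul, norm_mul, norm_mul, norm_mul]
  calc _ ≤ ‖(1 / 64 : ℂ)‖ * (1 * 1 * 2 * 4) := by gcongr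
    _ = 1 / 8 := by norm_num

theorem norm_baseTerm_le {k : ℂ} (hk : 0 ≤ k.re) (n : ℕ) : ‖baseTerm n k‖ ≤ (1 / 8) ^ n := by
  induction n with
  | zero => simp [baseTerm_zero]
  | succ n ih =>
    rw [baseTerm_succ, norm_mul, pow_succ]
    exact mul_le_mul ih (norm_baseRatio_le hk n) (norm_nonneg _) (by positivity)

theorem norm_rationalFactor_div_le {k : ℂ} (hk : 1 ≤ k.re) (n : ℕ) :
    ‖rationalFactor n k / k‖ ≤ 42 * n + 29 := by
  have h1 : 1 ≤ ‖k‖ := hk.trans (Complex.re_le_norm k)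
  have h0 : k ≠ 0 := norm_pos_iff.1 (by linarith)
  have h2 : ‖k / (2 * n + k + 1)‖ ≤ 1 := by
    apply norm_div_le_of_re_of_im one_pos.le <;> simp
    rw [abs_of_nonneg (by linarith)]
    have := Nat.cast_nonneg (α := ℝ) n
    linarith
  have h3 : rationalFactor n k / k = (42 * n + 5) / k + 21 + 3 * (k / (2 * n + k + 1)) := by
    rw [rationalFactor_eq (one_add_ne_of_re_nonneg (by linarith))]
    have := two_mul_add_one_ne_zero (one_add_ne_of_re_nonneg (show 0 ≤ k.re by linarith)) n
    generalize 2 * (n : ℂ) + k + 1 = v at this ⊢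
    field_simp
  have h4 : ‖(42 * n + 5) / k‖ ≤ 42 * n + 5 := by
    rw [norm_div]
    refine (div_le_self (norm_nonneg _) h1).trans ((norm_add_le _ _).trans ?_)
    simp
  rw [h3]
  refine (norm_add₃_le).trans ?_
  have h5 : ‖3 * (k / (2 * n + k + 1))‖ ≤ 3 := by
    rw [norm_mul]
    simpa using h2
  have h6 : ‖(21 : ℂ)‖ = 21 := by simp
  linarith

/-! ### The limit along `k + ℕ` -/

theorem tendsto_baseRatio_shift (k : ℂ) (n : ℕ) :
    Tendsto (fun N : ℕ => baseRatio n (k + (N + 1))) atTop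
      (𝓝 (1 / 64 * (-1 * ((1 / 2 + n) / (1 + n)) * (1 / (1 / 2)) * (2 / (1 / 2))))) := by
  have h1 := tendsto_affine_div (1 / 2 - (k + 1) + n) (1 + (k + 1) + n) (-1) (one_ne_zero' ℂ)
  have h2 := tendsto_affine_div (1 / 2 + (k + 1) + n) (1 + (k + 1) / 2 + n) 1
    (show (1 / 2 : ℂ) ≠ 0 by norm_num)
  have h3 := tendsto_affine_div (1 / 2 + 2 * (k + 1) + n) (1 / 2 + (k + 1) / 2 + n) 2
    (show (1 / 2 : ℂ) ≠ 0 by norm_num)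
  rw [div_one] at h1
  refine ((((h1.mul_const ((1 / 2 + n : ℂ) / (1 + n))).mul h2).mul h3).const_mul (1 / 64)).congr
    fun N => ?_
  have e1 : -1 * (N : ℂ) + (1 / 2 - (k + 1) + n) = 1 / 2 - (k + (N + 1)) + n := by ring
  have e2 : 1 * (N : ℂ) + (1 + (k + 1) + n) = 1 + (k + (N + 1)) + n := by ring
  have e3 : 1 * (N : ℂ) + (1 / 2 + (k + 1) + n) = 1 / 2 + (k + (N + 1)) + n := by ring
  have e4 : 1 / 2 * (N : ℂ) + (1 + (k + 1) / 2 + n) = 1 + (k + (N + 1)) / 2 + n := by ring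
  have e5 : 2 * (N : ℂ) + (1 / 2 + 2 * (k + 1) + n) = 1 / 2 + 2 * (k + (N + 1)) + n := by ring
  have e6 : 1 / 2 * (N : ℂ) + (1 / 2 + (k + 1) / 2 + n) = 1 / 2 + (k + (N + 1)) / 2 + n := by
    ring
  rw [baseRatio, e1, e2, e3, e4, e5, e6]

/-- The limit of `baseTerm n k` as `k` tends to infinity along a translate of `ℕ`. -/
noncomputable def limitTerm (n : ℕ) : ℂ :=
  ∏ j ∈ Finset.range n, 1 / 64 * (-1 * ((1 / 2 + j) / (1 + j)) * (1 / (1 / 2)) * (2 / (1 / 2)))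

theorem tendsto_baseTerm_shift (k : ℂ) (n : ℕ) :
    Tendsto (fun N : ℕ => baseTerm n (k + (N + 1))) atTop (𝓝 (limitTerm n)) := by
  induction n with
  | zero => simp [baseTerm_zero, limitTerm]
  | succ n ih =>
    simp only [baseTerm_succ, limitTerm, Finset.prod_range_succ]
    exact ih.mul (tendsto_baseRatio_shift k n)

/-- By `rationalFactor_eq` the growth in k comes from 21k and from 3k²/(2n + k + 1) ~ 3k, hence 24.
-/
theorem tendsto_rationalFactor_shift {k : ℂ} (hk : 0 ≤ k.re) (n : ℕ) :
    Tendsto (fun N : ℕ => rationalFactor n (k + (N + 1)) / (k + (N + 1))) atTop (𝓝 24) := by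
  have h1 := tendsto_const_div_affine (42 * n + 5) (k + 1) (one_ne_zero' ℂ)
  have h2 := tendsto_affine_div (k + 1) (2 * n + (k + 1) + 1) 1 (one_ne_zero' ℂ)
  have h3 := (h1.add_const 21).add (h2.const_mul 3)
  have e : (0 : ℂ) + 21 + 3 * (1 / 1) = 24 := by norm_num
  rw [e] at h3
  refine h3.congr fun N => ?_
  have hN : 0 < (k + (N + 1)).re := by
    have := Nat.cast_nonneg (α := ℝ) N
    simp
    linarith
  have h0 : k + (N + 1) ≠ 0 := fun h => by simp [h] at hN
  have h4 := two_mul_add_one_ne_zero (one_add_ne_of_re_nonneg hN.le) n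
  have e1 : 1 * (N : ℂ) + (k + 1) = k + (N + 1) := by ring
  have e2 : 1 * (N : ℂ) + (2 * n + (k + 1) + 1) = 2 * n + (k + (N + 1)) + 1 := by ring
  rw [rationalFactor_eq (one_add_ne_of_re_nonneg hN.le), e1, e2]
  generalize 2 * (n : ℂ) + (k + (N + 1)) + 1 = v at h4 ⊢
  generalize k + ((N : ℂ) + 1) = u at h0 ⊢
  field_simp

theorem tendsto_tsum_summand_shift {k : ℂ} (hk : 0 ≤ k.re) :
    Tendsto (fun N : ℕ => (∑' n, summand n (k + (N + 1))) / (k + (N + 1))) atTop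
      (𝓝 (∑' n, limitTerm n * 24)) := by
  simp only [← tsum_div_const, summand_eq, mul_div_assoc]
  refine tendsto_tsum_of_dominated_convergence
    (bound := fun n : ℕ => (1 / 8 : ℝ) ^ n * (42 * n + 29)) ?_
    (fun n => (tendsto_baseTerm_shift k n).mul (tendsto_rationalFactor_shift hk n)) ?_
  · have h1 := (summable_pow_mul_geometric_of_norm_lt_one 1
      (show ‖(1 / 8 : ℝ)‖ < 1 by norm_num)).mul_left 42
    have h2 := (summable_geometric_of_lt_one (show (0 : ℝ) ≤ 1 / 8 by norm_num)
      (by norm_num)).mul_left 29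
    refine (h1.add h2).congr fun n => ?_
    ring
  · refine .of_forall fun N n => ?_
    -- The offset N + 1 ensures real part at least 1, as the bound for `rationalFactor n k / k`
    -- requires.
    have hN : 1 ≤ (k + (N + 1)).re := by
      have := Nat.cast_nonneg (α := ℝ) N
      simp
      linarith
    rw [norm_mul]
    exact mul_le_mul (norm_baseTerm_le (by linarith) n) (norm_rationalFactor_div_le hN n)
      (norm_nonneg _) (by positivity)

/-! ### The sum for `0 ≤ re k` -/

theorem Gamma_add_natCast_add_one {s : ℂ} (hs : 0 < s.re) (n : ℕ) :
    Complex.Gamma (s + (n + 1)) = Complex.Gamma s * ∏ j ∈ Finset.range (n + 1), (s + j) := by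
  induction n with
  | zero =>
    have : s ≠ 0 := fun h => by simp [h] at hs
    simp [Complex.Gamma_add_one s this, mul_comm]
  | succ n ih =>
    have h : s + (n + 1) ≠ 0 := fun h => by
      have := congrArg Complex.re h
      have hn := Nat.cast_nonneg (α := ℝ) n
      simp at this
      linarith
    have e : s + ((n + 1 : ℕ) + 1) = s + (n + 1) + 1 := by push_cast; ring
    rw [e, Complex.Gamma_add_one _ h, ih, Finset.prod_range_succ _ (n + 1)]
    push_cast
    ring

theorem mem_domain_of_re_nonneg {k : ℂ} (hk : 0 ≤ k.re) : k ∈ domain := by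
  intro m
  have hm := Nat.cast_nonneg (α := ℝ) m
  refine ⟨one_add_ne_of_re_nonneg hk m, fun h => ?_, fun h => ?_⟩ <;>
  · have := congrArg Complex.re h
    norm_num at this
    linarith

/-- Γ(s + n + 1) is Γ(s) n^s n! divided by `GammaSeq s n`. The exponents leave w(k + n + 1) of order
1/n, and the Gamma values at 1 + k, 1/4 + k and 3/4 + k cancel in the limit. -/
theorem tendsto_weight_shift {k : ℂ} (hk : 0 ≤ k.re) :
    Tendsto (fun N : ℕ => (k + (N + 1)) * weight (k + (N + 1))) atTop
      (𝓝 (1 / (Complex.Gamma (1 / 4) * Complex.Gamma (3 / 4)))) := by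
  have hs (a : ℝ) (ha : 0 < a) : 0 < ((a : ℂ) + k).re := by simp; linarith
  have s1 : 0 < (1 + k).re := by simpa using hs 1 (by norm_num)
  have s2 : 0 < (1 / 4 + k).re := by simpa using hs (1 / 4) (by norm_num)
  have s3 : 0 < (3 / 4 + k).re := by simpa using hs (3 / 4) (by norm_num)
  have g1 := Complex.Gamma_ne_zero_of_re_pos s1
  have g2 := Complex.Gamma_ne_zero_of_re_pos s2
  have g3 := Complex.Gamma_ne_zero_of_re_pos s3
  have g4 : Complex.Gamma (1 / 4) ≠ 0 := Complex.Gamma_ne_zero_of_re_pos (by norm_num)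
  have g5 : Complex.Gamma (3 / 4) ≠ 0 := Complex.Gamma_ne_zero_of_re_pos (by norm_num)
  have h := ((((Complex.GammaSeq_tendsto_Gamma (1 + k)).pow 2).div
    ((Complex.GammaSeq_tendsto_Gamma (1 / 4 + k)).mul (Complex.GammaSeq_tendsto_Gamma (3 / 4 + k)))
    (mul_ne_zero g2 g3)).mul_const (weight k)).mul
      (tendsto_affine_div (k + 1) 0 1 (one_ne_zero' ℂ))
  have e : Complex.Gamma (1 + k) ^ 2 / (Complex.Gamma (1 / 4 + k) * Complex.Gamma (3 / 4 + k)) *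
      weight k * (1 / 1) = 1 / (Complex.Gamma (1 / 4) * Complex.Gamma (3 / 4)) := by
    simp only [weight, gammaPoch, Complex.Gamma_one]
    generalize Complex.Gamma (1 / 4 + k) = y2 at g2 ⊢
    generalize Complex.Gamma (3 / 4 + k) = y3 at g3 ⊢
    field_simp
  rw [e] at h
  refine h.congr' ?_
  filter_upwards [eventually_ne_atTop 0] with n hn
  have hn' : (n : ℂ) ≠ 0 := Nat.cast_ne_zero.2 hn
  have hf : (n.factorial : ℂ) ≠ 0 := Nat.cast_ne_zero.2 n.factorial_ne_zero
  have hp (s : ℂ) (hs : 0 < s.re) : ∏ j ∈ Finset.range (n + 1), (s + j) ≠ 0 := by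
    refine Finset.prod_ne_zero_iff.2 fun j _ h => ?_
    have := congrArg Complex.re h
    have hn := Nat.cast_nonneg (α := ℝ) j
    simp at this
    linarith
  have p1 := hp _ s1
  have p2 := hp _ s2
  have p3 := hp _ s3
  have hpow : (n : ℂ) ^ (1 / 4 + k) * (n : ℂ) ^ (3 / 4 + k) * n = ((n : ℂ) ^ (1 + k)) ^ 2 := by
    nth_rw 3 [← Complex.cpow_one (n : ℂ)]
    rw [← Complex.cpow_nat_mul, ← Complex.cpow_add _ _ hn', ← Complex.cpow_add _ _ hn']
    congr 1
    push_cast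
    ring
  have c2 : (n : ℂ) ^ (1 / 4 + k) ≠ 0 := by simp [Complex.cpow_eq_zero_iff, hn']
  have c3 : (n : ℂ) ^ (3 / 4 + k) ≠ 0 := by simp [Complex.cpow_eq_zero_iff, hn']
  simp only [weight, gammaPoch, ← add_assoc, Complex.GammaSeq, Pi.div_apply]
  rw [add_assoc (1 + k), add_assoc (1 / 4 + k), add_assoc (3 / 4 + k),
    Gamma_add_natCast_add_one s1, Gamma_add_natCast_add_one s2, Gamma_add_natCast_add_one s3,
    Complex.Gamma_one, div_pow, mul_pow, ← hpow, one_mul, add_zero]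
  generalize (n : ℂ) ^ (1 / 4 + k) = c2' at *
  generalize (n : ℂ) ^ (3 / 4 + k) = c3' at *
  generalize ∏ j ∈ Finset.range (n + 1), (1 + k + (j : ℂ)) = q1 at *
  generalize ∏ j ∈ Finset.range (n + 1), (1 / 4 + k + (j : ℂ)) = q2 at *
  generalize ∏ j ∈ Finset.range (n + 1), (3 / 4 + k + (j : ℂ)) = q3 at *
  generalize Complex.Gamma (1 / 4 + k) = y2 at g2 ⊢
  generalize Complex.Gamma (3 / 4 + k) = y3 at g3 ⊢
  field_simp
  ring

theorem tsum_mul_weight_shift {k : ℂ} (hk : k ∈ domain) :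
    (∑' n, summand n (k + 1)) * weight (k + 1) = (∑' n, summand n k) * weight k := by
  have hw := weight_shift hk
  have h := tsum_summand_shift fun m => (hk m).1
  have h0 : 1 + k ≠ 0 := by simpa using (hk 0).1
  apply mul_left_cancel₀ (pow_ne_zero 2 h0)
  linear_combination weight k * h + (∑' n, summand n (k + 1)) * hw

theorem tsum_mul_weight_eq_limit {k : ℂ} (hk : 0 ≤ k.re) :
    (∑' n, summand n k) * weight k =
      (∑' n, limitTerm n * 24) * (1 / (Complex.Gamma (1 / 4) * Complex.Gamma (3 / 4))) := by
  have h1 (N : ℕ) : 0 ≤ (k + N).re := by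
    have hN := Nat.cast_nonneg (α := ℝ) N
    simp
    linarith
  have h (N : ℕ) : (∑' n, summand n (k + N)) * weight (k + N) = (∑' n, summand n k) * weight k := by
    induction N with
    | zero => simp
    | succ N ih =>
      rw [← ih, ← tsum_mul_weight_shift (mem_domain_of_re_nonneg (h1 N)), Nat.cast_succ, add_assoc]
  -- The factors 1/(k + N + 1) and k + N + 1 cancel, so the product of the two convergent sequences
  -- is constant in N.
  refine tendsto_nhds_unique (tendsto_const_nhds.congr fun N => ?_)
    ((tendsto_tsum_summand_shift hk).mul (tendsto_weight_shift hk))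
  have h0 : k + (N + 1) ≠ 0 := fun h => by
    have h2 := h1 N
    have := congrArg Complex.re h
    simp at this h2
    linarith
  have h3 := h (N + 1)
  push_cast at h3
  rw [← h3]
  field_simp

theorem tsum_summand_half : ∑' n, summand n (1 / 2) = 16 := by
  rw [tsum_eq_single 0]
  · norm_num [summand_eq, baseTerm_zero, rationalFactor]
  · intro n hn
    obtain ⟨n, rfl⟩ := Nat.exists_eq_succ_of_ne_zero hn
    have : poch (1 / 2 - 1 / 2) (n + 1) = 0 := by
      induction n with
      | zero => simp [poch_succ]
      | succ n ih => rw [poch_succ, ih (by simp), zero_mul]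
    rw [summand, this]
    simp

/-- The numerator is Γ(5/4)/Γ(1/4) = 1/4, and Γ(3/2)² = π/4. -/
theorem weight_half : weight (1 / 2) = 1 / (Real.pi : ℂ) := by
  have h1 : Complex.Gamma (1 / 4) ≠ 0 := Complex.Gamma_ne_zero_of_re_pos (by norm_num)
  have h2 : Complex.Gamma (3 / 4) ≠ 0 := Complex.Gamma_ne_zero_of_re_pos (by norm_num)
  have e1 : (1 / 4 + 1 / 2 : ℂ) = 3 / 4 := by norm_num
  have e2 : (3 / 4 + 1 / 2 : ℂ) = 1 / 4 + 1 := by norm_num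
  have h3 : Complex.Gamma (1 / 2) ^ 2 = Real.pi := by
    rw [Complex.Gamma_one_half_eq, ← Complex.cpow_nat_mul]
    norm_num
  have h4 : (Real.pi : ℂ) ≠ 0 := by exact_mod_cast Real.pi_ne_zero
  rw [weight, gammaPoch, gammaPoch, gammaPoch, e1, e2, add_comm 1 (1 / 2 : ℂ),
    Complex.Gamma_add_one _ (by norm_num), Complex.Gamma_add_one _ (by norm_num), div_pow, mul_pow,
    h3, Complex.Gamma_one]
  field_simp
  norm_num

theorem tsum_mul_weight {k : ℂ} (hk : 0 ≤ k.re) :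
    (∑' n, summand n k) * weight k = 16 / (Real.pi : ℂ) := by
  rw [tsum_mul_weight_eq_limit hk, ← tsum_mul_weight_eq_limit (k := 1 / 2) (by norm_num),
    tsum_summand_half, weight_half, mul_one_div]

/-! ### The sum for general `k` -/

/-- The functional equation of 1/Γ has no exceptions, so passing to reciprocals removes the
conditions on 1/4 + k and 3/4 + k. `Complex.Gamma` is 0 at its poles, so the inverse there is 0, as
the convention for 1/Γ demands. -/
theorem inv_weight_shift {k : ℂ} (hk : ∀ m : ℕ, 1 + k ≠ -(m : ℂ)) :
    (1 / 4 + k) * (3 / 4 + k) * (weight (k + 1))⁻¹ = (1 + k) ^ 2 * (weight k)⁻¹ := by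
  have h0 : 1 + k ≠ 0 := by simpa using hk 0
  have h1 := Complex.one_div_Gamma_eq_self_mul_one_div_Gamma_add_one (1 / 4 + k)
  have h2 := Complex.one_div_Gamma_eq_self_mul_one_div_Gamma_add_one (3 / 4 + k)
  simp only [weight, gammaPoch, ← add_assoc, Complex.Gamma_add_one _ h0, mul_inv,
    div_eq_mul_inv, inv_inv, mul_pow] at *
  rw [h1, h2]
  ring

theorem tsum_summand_of_neg_natCast_le (m : ℕ) {k : ℂ} (hk : ∀ m : ℕ, 1 + k ≠ -(m : ℂ))
    (hm : -(m : ℝ) ≤ k.re) : ∑' n, summand n k = 16 / (Real.pi : ℂ) * (weight k)⁻¹ := by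
  induction m generalizing k with
  | zero =>
    have hre : 0 ≤ k.re := by simpa using hm
    have h := tsum_mul_weight hre
    -- Nonvanishing of the weight follows from the formula itself, since 16/π ≠ 0.
    have h0 : weight k ≠ 0 := fun h0 => by
      rw [h0, mul_zero, eq_comm, div_eq_zero_iff] at h
      norm_num at h
    rw [← h, mul_inv_cancel_right₀ h0]
  | succ m ih =>
    have h0 : 1 + k ≠ 0 := by simpa using hk 0
    have h1 := ih (one_add_succ_ne hk) (by push_cast at hm; simp; linarith)
    have h2 := tsum_summand_shift hk
    have h3 := inv_weight_shift hk
    rw [h1] at h2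
    apply mul_left_cancel₀ (pow_ne_zero 2 h0)
    linear_combination 16 / (Real.pi : ℂ) * h3 - h2

theorem hasSum_summand {k : ℂ} (hk : ∀ m : ℕ, 1 + k ≠ -(m : ℂ)) :
    HasSum (summand · k) (16 / (Real.pi : ℂ) *
      (gammaPoch 1 k ^ 2 / (gammaPoch (1 / 4) k * gammaPoch (3 / 4) k))) := by
  obtain ⟨m, hm⟩ := exists_nat_ge (-k.re)
  rw [← inv_div (_ * _), show _ / gammaPoch 1 k ^ 2 = weight k from rfl, ← tsum_summand_of_neg_natCast_le m hk (by linarith)]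
  exact (summable_summand hk).hasSum

/-! ### Ramanujan's series and the main theorem -/

theorem summand_zero_right (n : ℕ) : summand n 0 =
    (1 / 64 : ℂ) ^ n * (poch (1 / 2) n ^ 3 / poch 1 n ^ 3) * (42 * n + 5) := by
  have hp (m : ℕ) : 1 + (0 : ℂ) ≠ -(m : ℂ) := one_add_ne_of_re_nonneg (by simp) m
  have h1 (x : ℂ) (hx : 0 < x.re) : poch x n ≠ 0 := by
    induction n with
    | zero => simp [poch_zero]
    | succ n ih =>
      rw [poch_succ]
      refine mul_ne_zero ih fun h => ?_
      have := congrArg Complex.re h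
      have hn := Nat.cast_nonneg (α := ℝ) n
      simp at this
      linarith
  have h2 := h1 (1 / 2) (by norm_num)
  have h3 := h1 1 (by norm_num)
  rw [summand_eq, rationalFactor_eq hp, baseTerm]
  simp only [mul_zero, zero_div, add_zero, sub_zero, ne_eq, OfNat.ofNat_ne_zero, not_false_eq_true,
    zero_pow]
  field_simp

end RamanujanWZ

theorem mainTheorem7 :
    -- the summation formula, for every `k` for which the terms of the series are defined
    (∀ k : ℂ, (∀ m : ℕ, 1 + k ≠ -(m : ℂ)) →
      HasSum (fun n : ℕ => RamanujanWZ.summand n k)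
        (16 / (Real.pi : ℂ) *
          (RamanujanWZ.gammaPoch 1 k ^ 2 /
            (RamanujanWZ.gammaPoch (1 / 4) k * RamanujanWZ.gammaPoch (3 / 4) k)))) ∧
    -- it is WZ-demonstrable
    (∃ F : ℕ → ℂ → ℂ,
      RamanujanWZ.IsWZPairOn RamanujanWZ.domain F RamanujanWZ.G ∧
      (∀ k ∈ RamanujanWZ.domain, F 0 k = 0) ∧
      (∀ k ∈ RamanujanWZ.domain,
        Filter.Tendsto (fun n : ℕ => F n k) Filter.atTop (nhds 0))) ∧
    -- it generalizes the series of Ramanujan, which is the case `k = 0`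
    ((∀ n : ℕ, RamanujanWZ.summand n 0 =
        (1 / 64 : ℂ) ^ n * (RamanujanWZ.poch (1 / 2) n ^ 3 / RamanujanWZ.poch 1 n ^ 3) *
          (42 * n + 5)) ∧
      HasSum (fun n : ℕ =>
        (1 / 64 : ℂ) ^ n * (RamanujanWZ.poch (1 / 2) n ^ 3 / RamanujanWZ.poch 1 n ^ 3) *
          (42 * n + 5)) (16 / (Real.pi : ℂ))) := by
  refine ⟨fun k hk => RamanujanWZ.hasSum_summand hk,
    ⟨fun n k => RamanujanWZ.certificate n k * RamanujanWZ.weight k, RamanujanWZ.isWZPairOn,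
      fun k _ => ?_, fun k _ => ?_⟩, RamanujanWZ.summand_zero_right, ?_⟩
  · simp [RamanujanWZ.certificate]
  · simpa using (RamanujanWZ.tendsto_certificate k).mul_const (RamanujanWZ.weight k)
  · have h := RamanujanWZ.hasSum_summand (k := 0)
      (RamanujanWZ.one_add_ne_of_re_nonneg (by simp))
    simp only [RamanujanWZ.summand_zero_right] at h
    have h1 (x : ℂ) (hx : 0 < x.re) : RamanujanWZ.gammaPoch x 0 = 1 := by
      rw [RamanujanWZ.gammaPoch, add_zero, div_self (Complex.Gamma_ne_zero_of_re_pos hx)]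
    rwa [h1 1 (by norm_num), h1 (1 / 4) (by norm_num), h1 (3 / 4) (by norm_num), one_pow, mul_one,
      div_one, mul_one] at h
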